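/- Setting. Let $n\in\{2,3\}$ and let $\Omega\subset\mathbb R^n$ be a bounded domain, decomposed into finitely many pairwise disjoint, connected, flat subdomains $\Omega_i^d$ ($0\le d\le n$, $i\in I^d$), where $\Omega_i^d$ is relatively open in a $d$-dimensional affine subspace (for $d<n$: fractures and their intersections). Each side of $\Omega_i^d$ on which a $(d+1)$-dimensional subdomain lies is an interface $\Gamma_{ij}^d$, $j\in J_i^d$ (geometrically a copy of $\Omega_i^d$); $\Omega^d=\bigcup_i\Omega_i^d$, $\Gamma^d=\bigcup_{i,j}\Gamma_{ij}^d$. Let $\partial\Omega=\partial\Omega_D\cup\partial\Omega_N$ be a disjoint partition with $\partial\Omega_D$ of positive measure. Let $K$ be a symmetric positive definite tensor, constant on each subdomain, let $\gamma>0$ be constant on each interface, and let $K_\nu>0$ be bounded above and away from zero on each interface. Let $\mathcal T_\Omega^d$, $\mathcal T_\Gamma^d$ be simplicial triangulations of $\Omega^d$ and $\Gamma^d$, where the facets of $\mathcal T_\Omega^{d}$ resolve the interfaces, $\partial\Omega_D$ and $\partial\Omega_N$, and $\mathcal T_\Gamma^d$ need not match the other meshes. Say that $\mathcal T_\Omega$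 is shape regular with constant $\sigma$ if $\operatorname{diam}T\le\sigma\rho_T$ for each simplex $T$ of positive dimension, $\rho_T$ being the diameter of its inscribed ball. Let $\boldsymbol V_h^d=\mathbb{RT}_0(\mathcal T_\Omega^d)$ with $\boldsymbol v\cdot\boldsymbol\nu=0$ on $\partial\Omega_N$; let $\boldsymbol V_{0h}^d\subset\boldsymbol V_h^d$ be the subspace with $\boldsymbol v\cdot\boldsymbol\nu=0$ on $\Gamma^{d-1}$; and let $\Lambda_h^d=\mathbb P_0(\mathcal T_\Gamma^d)$, $Q_h^d=\mathbb P_0(\mathcal T_\Omega^d)$. Put $\boldsymbol V_{0h}=\bigoplus_{d=1}^n\boldsymbol V_{0h}^d$, $\Lambda_h=\bigoplus_{d=0}^{n-1}\Lambda_h^d$, $Q_h=\bigoplus_{d=0}^nQ_h^d$, $\boldsymbol W_h=\boldsymbol V_{0h}\times\Lambda_h$. Let $R_h=\bigoplus_d R_h^d$, where $R_h^d:\Lambda_h^d\to\boldsymbol V_h^{d+1}$ is a linear operator such that $R_h^d\mu\cdot\boldsymbol\nu$ equals, on $\Gamma^d$, the $L^2(\Gamma^d)$-projection of $\mu$ onto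 $\boldsymbol V_h^{d+1}\cdot\boldsymbol\nu|_{\Gamma^d}$, and is zero on the rest of the boundary. For $\boldsymbol w=[\boldsymbol u_0,\lambda]$ and $\boldsymbol r=[\boldsymbol v_0,\mu]$ in $\boldsymbol W_h$ and $q\in Q_h$, with $\boldsymbol u=\boldsymbol u_0+R_h\lambda$ and $\boldsymbol v=\boldsymbol v_0+R_h\mu$, put $$a(\boldsymbol w,\boldsymbol r)=(K^{-1}\boldsymbol u,\boldsymbol v)_\Omega+(\gamma K_\nu^{-1}\lambda,\mu)_\Gamma,\qquad b(\boldsymbol r,q)=-(q,\nabla\cdot\boldsymbol v+[\![\mu]\!])_\Omega,\qquad [\![\mu]\!]|_{\Omega_i^d}=-\sum_{j}\mu_{ij}^d,$$ $$a^D(\boldsymbol w,\boldsymbol r)=\sum_{d=1}^n\sum_{T\in\mathcal T_\Omega^d}\sum_{f\subset\partial T}(\boldsymbol u\cdot\boldsymbol\nu_f)(\boldsymbol v\cdot\boldsymbol\nu_f)(K^{-1}\boldsymbol\phi_f,\boldsymbol\phi_f)_T+(\gamma K_\nu^{-1}\lambda,\mu)_\Gamma,$$ where $\boldsymbol\phi_f\in\mathbb{RT}_0(T)$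 is the basis function with normal component $1$ on the facet $f$ and $0$ on the other facets. Put $\|\boldsymbol r\|_a=a(\boldsymbol r,\boldsymbol r)^{1/2}$, $\|\boldsymbol r\|_{a^D}=a^D(\boldsymbol r,\boldsymbol r)^{1/2}$. The discrete gradient $\boldsymbol D_h:Q_h\to\boldsymbol W_h$ is the linear operator with $a^D(\boldsymbol D_hq,\boldsymbol r)=b(\boldsymbol r,q)$ for all $\boldsymbol r\in\boldsymbol W_h$, $q\in Q_h$. Statement. For every $\sigma$ there is a constant $c_2>0$, depending only on $\sigma$, such that for all $n$, geometries, meshes and parameters as above with $\mathcal T_\Omega$ shape regular with constant $\sigma$: operators $R_h$ as above exist, and, for each of them, $\|\boldsymbol r\|_a\le c_2\|\boldsymbol r\|_{a^D}$ for all $\boldsymbol r\in\boldsymbol W_h$, the discrete gradient $\boldsymbol D_h$ exists and is unique, and with $\beta_\star=c_2^{-1}$, $$\inf_{q\in Q_h,\ \boldsymbol D_hq\neq0}\ \sup_{0\neq\boldsymbol r\in\boldsymbol W_h}\frac{a^D(\boldsymbol D_hq,\boldsymbol r)}{\|\boldsymbol r\|_a\,\|\boldsymbol D_hq\|_{a^D}}\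 \ge\ \beta_\star .$$ In particular $\beta_\star$ is independent of the mesh size and of $K$, $K_\nu$, $\gamma$. -/

import Mathlib

open MeasureTheory Topology Module

noncomputable section

namespace MixedDim

/-! ### Mixed-dimensional geometry -/

/-- The ambient Euclidean space `ℝⁿ`. -/
abbrev Space (n : ℕ) : Type := EuclideanSpace ℝ (Fin n)

/-- A finite family of flat subdomains `Ω_i^d` (`i ∈ I^d`) of `ℝⁿ`: each `Ω_i^d` is a
connected, relatively open, non-empty subset of a `d`-dimensional affine subspace, and
the subdomains are pairwise disjoint. (For `d > n` the index set `I^d` is automatically empty; for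
`d = 0` a subdomain is a point.) -/
structure Decomposition (n : ℕ) where
  I : ℕ → Type
  fintypeI : ∀ d, Fintype (I d)
  /-- the affine subspace (the plane of `Ω_i^d`) -/
  aff : ∀ d, I d → AffineSubspace ℝ (Space n)
  finrank_aff : ∀ d i, finrank ℝ (aff d i).direction = d
  /-- the subdomain `Ω_i^d` -/
  dom : ∀ d, I d → Set (Space n)
  dom_relOpen : ∀ d i, ∃ U : Set (Space n), IsOpen U ∧ dom d i = U ∩ (aff d i : Set (Space n))
  dom_connected : ∀ d i, IsConnected (dom d i)
  dom_disjoint : Pairwise fun p q : (Σ d, I d) => Disjoint (dom p.1 p.2) (dom q.1 q.2)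

attribute [instance] Decomposition.fintypeI

namespace Decomposition

variable {n : ℕ} (G : Decomposition n)

/-- `Ω = ⋃_d ⋃_i Ω_i^d`. -/
def omega : Set (Space n) := ⋃ d, ⋃ i, G.dom d i

/-- The tangent space of `Ω_i^d`. -/
abbrev dir (d : ℕ) (i : G.I d) : Submodule ℝ (Space n) := (G.aff d i).direction

/-- Seen from the point `x` against the direction `e`, one enters the `(d+1)`-dimensional subdomain
`Ω_k^{d+1}`: thus `e` points out of `Ω_k^{d+1}` at `x`. -/
def SideAt {d : ℕ} (x : Space n) (k : G.I (d + 1)) (e : Space n) : Prop :=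
  ∀ᶠ s in 𝓝[>] (0 : ℝ), x - s • e ∈ G.dom (d + 1) k

end Decomposition

/-- The fractured porous medium. `Ω` is a bounded domain of `ℝⁿ`, decomposed into the subdomains
`Ω_i^d`. For each `Ω_i^d`, the set `J d i` enumerates the interfaces `Γ_{ij}^d`. An interface is one
side of `Ω_i^d`: it has the same location as `Ω_i^d` and is the part of the boundary of the
`(d+1)`-dimensional subdomain `up d i j` which lies on that side; `normal d i j` is the unit normal
on it that points out of `up d i j`. Both sides of a fracture may belong to the same
`(d+1)`-dimensional subdomain. The boundary `∂Ω` (which contains immersed fracture tips) is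
partitioned into a Dirichlet part of positive measure and a Neumann part. -/
structure Geometry (n : ℕ) extends Decomposition n where
  omega_open : IsOpen toDecomposition.omega
  omega_connected : IsConnected toDecomposition.omega
  omega_bounded : Bornology.IsBounded toDecomposition.omega
  J : ∀ d, I d → Type
  fintypeJ : ∀ d i, Fintype (J d i)
  up : ∀ d i, J d i → I (d + 1)
  normal : ∀ d i, J d i → Space n
  normal_unit : ∀ d i j, ‖normal d i j‖ = 1
  normal_orth : ∀ d i j, ∀ v ∈ (aff d i).direction, inner ℝ v (normal d i j) = 0
  normal_side : ∀ d i j, ∀ x ∈ dom d i, toDecomposition.SideAt x (up d i j) (normal d i j)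
  /-- every side of `Ω_i^d` is listed exactly once -/
  side_unique : ∀ d i, ∀ x ∈ dom d i, ∀ (k : I (d + 1)) (e : Space n), ‖e‖ = 1 →
    (∀ v ∈ (aff d i).direction, inner ℝ v e = 0) → toDecomposition.SideAt x k e →
    ∃! j : J d i, up d i j = k ∧ normal d i j = e
  bdD : Set (Space n)
  bdN : Set (Space n)
  bd_union : bdD ∪ bdN = frontier toDecomposition.omega
  bd_disjoint : Disjoint bdD bdN
  bdD_pos : 0 < μHE[n - 1] bdD

attribute [instance] Geometry.fintypeJ

/-- The physical parameters: on each subdomain a constant symmetric positive definite permeability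
tensor `K` acting on tangential vectors, on each interface a normal permeability `K_ν`, bounded from
above and away from zero, and a constant `γ > 0`. -/
structure Params {n : ℕ} (G : Geometry n) where
  K : ∀ d (i : G.I d), G.dir d i ≃ₗ[ℝ] G.dir d i
  K_symm : ∀ d i u v, inner ℝ (K d i u) v = inner ℝ u (K d i v)
  K_pos : ∀ d i u, u ≠ 0 → 0 < inner ℝ (K d i u) u
  Kν : ∀ d (i : G.I d), G.J d i → Space n → ℝ
  Kν_measurable : ∀ d i j, Measurable (Kν d i j)
  Kν_bounds : ∀ d i j, ∃ m M : ℝ, 0 < m ∧ ∀ x ∈ closure (G.dom d i),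
    m ≤ Kν d i j x ∧ Kν d i j x ≤ M
  γ : ∀ d (i : G.I d), G.J d i → ℝ
  γ_pos : ∀ d i j, 0 < γ d i j

/-! ### Simplices and triangulations -/

/-- The relatively open simplex: all barycentric coordinates are positive (for `d = 0`, the
point). -/
def openCell {n d : ℕ} (t : Affine.Simplex ℝ (Space n) d) : Set (Space n) :=
  t.setInterior (Set.Ioi 0)

/-- The facet of a `(d+1)`-simplex opposite to its vertex `k`. -/
def facet {n d : ℕ} (t : Affine.Simplex ℝ (Space n) (d + 1)) (k : Fin (d + 2)) :
    Affine.Simplex ℝ (Space n) d :=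
  t.faceOpposite k

/-- The unit outer normal (in the plane of the simplex) on the facet opposite to the vertex `k`. -/
def outerNormal {n d : ℕ} (t : Affine.Simplex ℝ (Space n) (d + 1)) (k : Fin (d + 2)) : Space n :=
  (t.height k)⁻¹ • (t.altitudeFoot k - t.points k)

/-- A conforming triangulation of (the closure of) a relatively open set `S` by `d`-simplices.
Conformity is required inside `S`; the two sides of a slit of `S` need not match. -/
structure Triangulation {n : ℕ} (d : ℕ) (S : Set (Space n)) where
  ι : Type
  fintypeι : Fintype ι
  cell : ι → Affine.Simplex ℝ (Space n) d
  openCell_subset : ∀ t, openCell (cell t) ⊆ S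
  iUnion_cell : ⋃ t, (cell t).closedInterior = closure S
  disjoint : Pairwise fun t t' => Disjoint (openCell (cell t)) (openCell (cell t'))
  conforming : ∀ t t', S ∩ (cell t).closedInterior ∩ (cell t').closedInterior ⊆
    convexHull ℝ (Set.range (cell t).points ∩ Set.range (cell t').points)

attribute [instance] Triangulation.fintypeι

/-- The function which is constant on each open simplex, with the given values. -/
def Triangulation.toFun {n d : ℕ} {S : Set (Space n)} (T : Triangulation d S) (c : T.ι → ℝ)
    (x : Space n) : ℝ :=
  ∑ t, (openCell (T.cell t)).indicator (fun _ => c t) x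

/-- The meshes `𝒯_Ω` of the subdomains and `𝒯_Γ` of the interfaces (the mortar meshes), which need
not match. The mesh of `Ω^{d+1}` resolves the parts of its boundary: each of its facets lies inside
the subdomain, or on a `d`-dimensional subdomain, or on the Dirichlet or the Neumann boundary. -/
structure Mesh {n : ℕ} (G : Geometry n) where
  sub : ∀ d (i : G.I d), Triangulation d (G.dom d i)
  mortar : ∀ d (i : G.I d), G.J d i → Triangulation d (G.dom d i)
  facet_cases : ∀ d (i : G.I (d + 1)) (t : (sub (d + 1) i).ι) (k : Fin (d + 2)),
    openCell (facet ((sub (d + 1) i).cell t) k) ⊆ G.dom (d + 1) i ∨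
    (∃ i' : G.I d, openCell (facet ((sub (d + 1) i).cell t) k) ⊆ G.dom d i') ∨
    openCell (facet ((sub (d + 1) i).cell t) k) ⊆ G.bdD ∨
    openCell (facet ((sub (d + 1) i).cell t) k) ⊆ G.bdN

/-! ### Raviart–Thomas functions on one simplex -/

section Local

variable {n : ℕ} (S : Submodule ℝ (Space n))

/-- The lowest-order Raviart–Thomas space on a simplex with tangent space `S`: the pair `(a, b)`
stands for the tangential vector field `x ↦ a + b x` (see `RT.eval`). -/
abbrev RT : Type := S × ℝ

variable {S}

/-- The field `x ↦ a + b P x`, with the orthogonal projection `P` onto the tangent space `S`. On an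
affine subspace of direction `S`, the vector `P x` is `x` up to a constant. -/
def RT.eval (v : RT S) (x : Space n) : S := v.1 + v.2 • S.orthogonalProjectionOnto x

/-- The (tangential, constant) divergence of `x ↦ a + b P x` on a `(d+1)`-dimensional simplex. -/
def RT.div (d : ℕ) (v : RT S) : ℝ := ((d + 1 : ℕ) : ℝ) * v.2

/-- The normal component `v · ν_f` on the facet `f` opposite to the vertex `k`. It is constant on
the hyperplane of the facet, and taken here at the foot of the altitude. -/
def RT.flux {d : ℕ} (t : Affine.Simplex ℝ (Space n) (d + 1)) (k : Fin (d + 2)) (v : RT S) : ℝ :=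
  inner ℝ (v.eval (t.altitudeFoot k) : Space n) (outerNormal t k)

variable (S)

/-- The Raviart–Thomas basis function `φ_f(x) = (x - p_k) / h_k` of the facet `f` opposite to the
vertex `p_k`, of height `h_k`: its normal component is `1` on `f` and `0` on the other facets. -/
def RT.basis {d : ℕ} (t : Affine.Simplex ℝ (Space n) (d + 1)) (k : Fin (d + 2)) : RT S :=
  (-((t.height k)⁻¹ • S.orthogonalProjectionOnto (t.points k)), (t.height k)⁻¹)

end Local

namespace Mesh

variable {n : ℕ} {G : Geometry n} (M : Mesh G)

/-- Shape regularity of `𝒯_Ω` with constant `σ`: the diameter of each simplex is at most `σ` times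
the diameter of its inscribed ball. -/
def ShapeRegular (σ : ℝ) : Prop :=
  ∀ d (i : G.I (d + 1)) (t : (M.sub (d + 1) i).ι),
    Metric.diam ((M.sub (d + 1) i).cell t).closedInterior ≤
      σ * (2 * ((M.sub (d + 1) i).cell t).inradius)

/-! ### Discrete spaces -/

/-- `Q_h^d`: piecewise constants on the mesh of `Ω^d`. -/
abbrev Qd (d : ℕ) : Type := ∀ i : G.I d, (M.sub d i).ι → ℝ

/-- `Λ_h^d`: piecewise constants on the mortar mesh of `Γ^d`. -/
abbrev Ld (d : ℕ) : Type := ∀ (i : G.I d) (j : G.J d i), (M.mortar d i j).ι → ℝ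

/-- Fields on `Ω^{d+1}` that are Raviart–Thomas functions on each simplex, without any continuity
between simplices. -/
abbrev Xd (d : ℕ) : Type := ∀ i : G.I (d + 1), (M.sub (d + 1) i).ι → RT (G.dir (d + 1) i)

variable {M} in
/-- The normal component of a piecewise field on the facet `(t, k)`, outward from `t`. -/
def flux {d : ℕ} (v : M.Xd d) (i : G.I (d + 1)) (t : (M.sub (d + 1) i).ι) (k : Fin (d + 2)) : ℝ :=
  (v i t).flux ((M.sub (d + 1) i).cell t) k

/-- The facet of the simplex `t` opposite to its vertex `k`. -/
abbrev fct {d : ℕ} (i : G.I (d + 1)) (t : (M.sub (d + 1) i).ι) (k : Fin (d + 2)) :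
    Affine.Simplex ℝ (Space n) d :=
  facet ((M.sub (d + 1) i).cell t) k

/-- The facet `(t, k)` of the mesh of `up d i j` lies on the interface `Γ_{ij}^d`: it has the same
location and lies on the same side. -/
def OnInterface {d : ℕ} (i : G.I d) (j : G.J d i) (t : (M.sub (d + 1) (G.up d i j)).ι)
    (k : Fin (d + 2)) : Prop :=
  openCell (M.fct (G.up d i j) t k) ⊆ G.dom d i ∧
    outerNormal ((M.sub (d + 1) (G.up d i j)).cell t) k = G.normal d i j

/-- `V_h^{d+1}`, the lowest-order Raviart–Thomas space on `Ω^{d+1}`: the normal component is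
continuous across the facets inside each subdomain and vanishes on the Neumann boundary. -/
def Vd (d : ℕ) : Submodule ℝ (M.Xd d) where
  carrier := {v |
    (∀ (i : G.I (d + 1)) (t t' : (M.sub (d + 1) i).ι) (k k' : Fin (d + 2)), t ≠ t' →
      Set.range (M.fct i t k).points = Set.range (M.fct i t' k').points →
      openCell (M.fct i t k) ⊆ G.dom (d + 1) i → flux v i t k + flux v i t' k' = 0) ∧
    ∀ (i : G.I (d + 1)) (t : (M.sub (d + 1) i).ι) (k : Fin (d + 2)),
      openCell (M.fct i t k) ⊆ G.bdN → flux v i t k = 0}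
  add_mem' := by
    rintro v w ⟨hv, hv'⟩ ⟨hw, hw'⟩
    have key : ∀ i t k, flux (v + w) i t k = flux v i t k + flux w i t k := by
      intro i t k
      simp only [flux, RT.flux, RT.eval, Pi.add_apply, Prod.fst_add, Prod.snd_add, add_smul,
        Submodule.coe_add, inner_add_left]
      ring
    refine ⟨fun i t t' k k' h1 h2 h3 => ?_, fun i t k h => ?_⟩
    · rw [key, key]
      linarith [hv i t t' k k' h1 h2 h3, hw i t t' k k' h1 h2 h3]
    · rw [key, hv' i t k h, hw' i t k h, add_zero]
  zero_mem' := by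
    have key : ∀ i t k, flux (0 : M.Xd d) i t k = 0 := by
      intro i t k
      simp [flux, RT.flux, RT.eval]
    exact ⟨fun i t t' k k' _ _ _ => by rw [key, key, add_zero], fun i t k _ => key i t k⟩
  smul_mem' := by
    rintro c v ⟨hv, hv'⟩
    have key : ∀ i t k, flux (c • v) i t k = c * flux v i t k := by
      intro i t k
      simp only [flux, RT.flux, RT.eval, Pi.smul_apply, Prod.smul_fst, Prod.smul_snd, smul_assoc,
        ← smul_add, Submodule.coe_smul, real_inner_smul_left]
    refine ⟨fun i t t' k k' h1 h2 h3 => ?_, fun i t k h => ?_⟩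
    · rw [key, key, ← mul_add, hv i t t' k k' h1 h2 h3, mul_zero]
    · rw [key, hv' i t k h, mul_zero]

/-- `V_{0h}^{d+1}`: the functions of `V_h^{d+1}` whose normal component vanishes on `Γ^d`. -/
def V0d (d : ℕ) : Submodule ℝ (M.Xd d) where
  carrier := {v | v ∈ M.Vd d ∧
    ∀ (i : G.I d) (j : G.J d i) (t : (M.sub (d + 1) (G.up d i j)).ι) (k : Fin (d + 2)),
      M.OnInterface i j t k → flux v (G.up d i j) t k = 0}
  add_mem' := by
    rintro v w ⟨hv, hv'⟩ ⟨hw, hw'⟩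
    refine ⟨(M.Vd d).add_mem hv hw, fun i j t k h => ?_⟩
    have h1 := hv' i j t k h
    have h2 := hw' i j t k h
    simp only [flux, RT.flux, RT.eval, Pi.add_apply, Prod.fst_add, Prod.snd_add, add_smul,
      Submodule.coe_add, inner_add_left] at h1 h2 ⊢
    linarith
  zero_mem' := ⟨(M.Vd d).zero_mem, fun i j t k _ => by simp [flux, RT.flux, RT.eval]⟩
  smul_mem' := by
    rintro c v ⟨hv, hv'⟩
    refine ⟨(M.Vd d).smul_mem c hv, fun i j t k h => ?_⟩
    have h1 := hv' i j t k h
    simp only [flux, RT.flux, RT.eval, Pi.smul_apply, Prod.smul_fst, Prod.smul_snd, smul_assoc,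
      ← smul_add, Submodule.coe_smul, real_inner_smul_left] at h1 ⊢
    rw [h1, mul_zero]

/-- `Q_h = ⨁_{d=0}^n Q_h^d`. -/
abbrev Q : Type := ∀ d : Fin (n + 1), M.Qd d

/-- `Λ_h = ⨁_{d=0}^{n-1} Λ_h^d`. -/
abbrev L : Type := ∀ d : Fin n, M.Ld d

/-- `W_h = V_{0h} × Λ_h`, with `V_{0h} = ⨁_{d=1}^n V_{0h}^d`. -/
abbrev W : Type := (∀ d : Fin n, M.V0d d) × M.L

/-! ### The discrete extension operator -/

open Classical in
/-- `R_h^d : Λ_h^d → V_h^{d+1}` is a discrete extension operator: on `Γ^d`, the normal component of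
`R_h^d μ` is the `L²(Γ^d)`-projection of `μ` onto the space of normal traces of `V_h^{d+1}`, that
is, `(R_h^d μ · ν - μ, v · ν)_{Γ^d} = 0` for all `v ∈ V_h^{d+1}`; on the rest of the boundary of
`Ω^{d+1}` it is zero. -/
def IsExtension (d : ℕ) (R : M.Ld d →ₗ[ℝ] M.Vd d) : Prop :=
  (∀ (μ : M.Ld d) (v : M.Vd d),
    ∑ i : G.I d, ∑ j : G.J d i, ∑ t : (M.sub (d + 1) (G.up d i j)).ι, ∑ k : Fin (d + 2),
      (if M.OnInterface i j t k then
        ∫ x in (M.fct (G.up d i j) t k).closedInterior,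
          (flux (R μ : M.Xd d) (G.up d i j) t k - (M.mortar d i j).toFun (μ i j) x) *
            flux (v : M.Xd d) (G.up d i j) t k ∂μHE[d]
      else 0) = 0) ∧
  ∀ (μ : M.Ld d) (i : G.I (d + 1)) (t : (M.sub (d + 1) i).ι) (k : Fin (d + 2)),
    openCell (M.fct i t k) ⊆ G.bdD ∪ G.bdN → flux (R μ : M.Xd d) i t k = 0

variable {M}

/-- `v_{0h} + R_h μ_h` for `[v_{0h}, μ_h] ∈ W_h`, with `R_h = ⨁_d R_h^d`. -/
def total (R : ∀ d : Fin n, M.Ld d →ₗ[ℝ] M.Vd d) (r : M.W) (d : Fin n) : M.Xd d :=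
  (r.1 d : M.Xd d) + (R d (r.2 d) : M.Xd d)

/-! ### Bilinear forms -/

variable (P : Params G)

/-- `(γ K_ν⁻¹ λ, μ)_Γ`. -/
def formΓ (l m : M.L) : ℝ :=
  ∑ d : Fin n, ∑ i : G.I d, ∑ j : G.J d i, ∑ τ : (M.mortar d i j).ι,
    ∫ x in ((M.mortar d i j).cell τ).closedInterior,
      P.γ d i j * (P.Kν d i j x)⁻¹ * l d i j τ * m d i j τ ∂μHE[d]

/-- `(K⁻¹ u, v)_T` for Raviart–Thomas functions `u`, `v` on a simplex `T` of `Ω_i^{d+1}`. -/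
def formCell {d : ℕ} (i : G.I (d + 1)) (t : (M.sub (d + 1) i).ι) (u v : RT (G.dir (d + 1) i)) : ℝ :=
  ∫ x in ((M.sub (d + 1) i).cell t).closedInterior,
    inner ℝ ((P.K (d + 1) i).symm (u.eval x)) (v.eval x) ∂μHE[d + 1]

/-- `a(w, r) = (K⁻¹ (u₀ + R_h λ), v₀ + R_h μ)_Ω + (γ K_ν⁻¹ λ, μ)_Γ`. -/
def a (R : ∀ d : Fin n, M.Ld d →ₗ[ℝ] M.Vd d) (w r : M.W) : ℝ :=
  (∑ d : Fin n, ∑ i : G.I (d + 1), ∑ t : (M.sub (d + 1) i).ι,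
    formCell P i t (total R w d i t) (total R r d i t)) + formΓ P w.2 r.2

/-- `a^D(w, r)`: as `a`, with `(K⁻¹ u, v)_T` replaced by its diagonal part
`∑_f (u · ν_f) (v · ν_f) (K⁻¹ φ_f, φ_f)_T`. -/
def aD (R : ∀ d : Fin n, M.Ld d →ₗ[ℝ] M.Vd d) (w r : M.W) : ℝ :=
  (∑ d : Fin n, ∑ i : G.I (d + 1), ∑ t : (M.sub (d + 1) i).ι, ∑ k : Fin ((d : ℕ) + 2),
    flux (total R w d) i t k * flux (total R r d) i t k *
      formCell P i t (RT.basis (G.dir (d + 1) i) ((M.sub (d + 1) i).cell t) k)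
        (RT.basis (G.dir (d + 1) i) ((M.sub (d + 1) i).cell t) k)) + formΓ P w.2 r.2

/-- The jump `⟦μ⟧` on `Ω_i^d`, namely `- ∑_j μ_{ij}`. -/
def jump {d : ℕ} (m : M.Ld d) (i : G.I d) (x : Space n) : ℝ :=
  -∑ j : G.J d i, (M.mortar d i j).toFun (m i j) x

/-- `b(r, q) = -(q, ∇ · (v₀ + R_h μ) + ⟦μ⟧)_Ω`. -/
def b (R : ∀ d : Fin n, M.Ld d →ₗ[ℝ] M.Vd d) (r : M.W) (q : M.Q) : ℝ :=
  -((∑ d : Fin n, ∑ i : G.I (d + 1), ∑ t : (M.sub (d + 1) i).ι,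
      ∫ _x in ((M.sub (d + 1) i).cell t).closedInterior,
        q ⟨d + 1, by omega⟩ i t * (total R r d i t).div d ∂μHE[(d : ℕ) + 1]) +
    ∑ d : Fin n, ∑ i : G.I d,
      ∫ x in G.dom d i,
        (M.sub d i).toFun (q ⟨d, by omega⟩ i) x * jump (r.2 d) i x ∂μHE[d])

/-- `‖r‖_a`. -/
def normA (R : ∀ d : Fin n, M.Ld d →ₗ[ℝ] M.Vd d) (r : M.W) : ℝ := √(a P R r r)

/-- `‖r‖_{a^D}`. -/
def normAD (R : ∀ d : Fin n, M.Ld d →ₗ[ℝ] M.Vd d) (r : M.W) : ℝ := √(aD P R r r)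

/-- `D_h : Q_h → W_h` is the discrete gradient: `a^D(D_h q, r) = b(r, q)` for all `r ∈ W_h`. -/
def IsDiscreteGradient (R : ∀ d : Fin n, M.Ld d →ₗ[ℝ] M.Vd d) (D : M.Q →ₗ[ℝ] M.W) : Prop :=
  ∀ q r, aD P R (D q) r = b R r q

end Mesh

end MixedDim

end

noncomputable section

namespace MixedDim

/-! ### Measures of simplices -/

section Simplex

variable {n d : ℕ}

/-! The norm comparison is local. On a simplex of dimension `d + 1` the facet functions form a basis
of the Raviart–Thomas space dual to the normal components, so a field is `u = ∑_f (u · ν_f) φ_f`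
with `d + 2` terms (`RT.flux_basis`, `RT.sum_flux_smul_basis`). For a positive semidefinite form,
the value at a sum of `N` vectors is at most `N` times the sum of the diagonal values
(`apply_sum_self_le`). Hence `(K⁻¹u, u)_T` is at most `d + 2 ≤ n + 1` times its diagonal part. The
interface terms of the two forms agree, so `a ≤ (n + 1) a^D ≤ 4 a^D` on the diagonal, and `c₂ = 2`.

The form `a` is definite (`eq_zero_of_a_self_eq_zero`): the interface term forces `λ = 0`, then `R_h
λ = 0`, and the cell terms force `u₀ = 0`. By the comparison `a^D` is definite too, so it identifies
the finite-dimensional `W_h` with its dual, and `D_h` exists and is unique. The inf-sup bound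
follows by testing with `r = D_h q`: the quotient becomes `‖D_h q‖_{a^D} / ‖D_h q‖_a ≥ 1 / c₂`.

An extension operator is built from the means of `μ` over the facets on interfaces, with zero normal
component on all other facets (`isExtension_extension`).

The measure theory supplies finiteness, for integrability, and positivity on relatively open sets,
for definiteness. -/

theorem exists_isometry_range_eq (A : AffineSubspace ℝ (Space n)) (hA : finrank ℝ A.direction = d)
    (hne : (A : Set (Space n)).Nonempty) :
    ∃ φ : EuclideanSpace ℝ (Fin d) → Space n, Isometry φ ∧ Set.range φ = A := by
  obtain ⟨p, hp⟩ := hne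
  let L := ((stdOrthonormalBasis ℝ A.direction).reindex (finCongr hA)).repr.symm
  refine ⟨fun y => ((L y : A.direction) : Space n) + p, ?_, ?_⟩
  · exact (isometry_add_right p).comp (isometry_subtype_coe.comp L.isometry)
  · ext x
    constructor
    · rintro ⟨y, rfl⟩
      exact AffineSubspace.vadd_mem_of_mem_direction (L y).2 hp
    · intro hx
      refine ⟨L.symm ⟨x - p, AffineSubspace.vsub_mem_direction hx hp⟩, ?_⟩
      simp

/-- An isometric parametrisation of the plane turns the Hausdorff measure into Lebesgue measure on
`ℝᵈ`. The next lemma uses the same transfer. -/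
theorem hausdorff_lt_top {A : AffineSubspace ℝ (Space n)} (hA : finrank ℝ A.direction = d)
    {B : Set (Space n)} (hBA : B ⊆ A) (hB : Bornology.IsBounded B) : μHE[d] B < ⊤ := by
  rcases B.eq_empty_or_nonempty with rfl | hne
  · simp
  obtain ⟨φ, hφ, hr⟩ := exists_isometry_range_eq A hA (hne.mono hBA)
  rw [← Set.image_preimage_eq_of_subset (hr.symm ▸ hBA : B ⊆ Set.range φ),
    hφ.euclideanHausdorffMeasure_image, EuclideanSpace.euclideanHausdorffMeasure_eq_volume]
  exact (hφ.antilipschitz.isBounded_preimage hB).measure_lt_top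

theorem hausdorff_pos {A : AffineSubspace ℝ (Space n)} (hA : finrank ℝ A.direction = d)
    {U : Set (Space n)} (hU : IsOpen U) (hne : (U ∩ A).Nonempty) : 0 < μHE[d] (U ∩ A) := by
  obtain ⟨φ, hφ, hr⟩ := exists_isometry_range_eq A hA (hne.mono Set.inter_subset_right)
  rw [← hr, ← Set.image_preimage_eq_inter_range, hφ.euclideanHausdorffMeasure_image,
    EuclideanSpace.euclideanHausdorffMeasure_eq_volume]
  refine (hU.preimage hφ.continuous).measure_pos _ ?_
  rw [← hr] at hne
  obtain ⟨_, hx, y, rfl⟩ := hne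
  exact ⟨y, hx⟩

variable (t : Affine.Simplex ℝ (Space n) d)

theorem finrank_direction_affineSpan_points :
    finrank ℝ (affineSpan ℝ (Set.range t.points)).direction = d := by
  rw [direction_affineSpan]
  exact t.independent.finrank_vectorSpan (by simp)

theorem openCell_subset_affineSpan :
    openCell t ⊆ affineSpan ℝ (Set.range t.points) :=
  t.setInterior_subset_affineSpan

theorem openCell_subset_closedInterior : openCell t ⊆ t.closedInterior := by
  rintro x ⟨w, hw, hpos, rfl⟩
  refine ⟨w, hw, fun i => ⟨(hpos i).le, ?_⟩, rfl⟩
  rw [← hw]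
  exact Finset.single_le_sum (fun j _ => (hpos j).le) (Finset.mem_univ i)

theorem openCell_nonempty : (openCell t).Nonempty := by
  refine ⟨_, fun _ => ((d : ℝ) + 1)⁻¹, ?_, fun _ => ?_, rfl⟩
  · simp
    field_simp
  · simp only [Set.mem_Ioi]
    positivity

variable {t} in
-- The simplices differ only by a renumbering of vertices. This identifies a facet shared by two
-- neighbouring cells.
theorem openCell_eq_of_range_eq {t' : Affine.Simplex ℝ (Space n) d}
    (h : Set.range t.points = Set.range t'.points) : openCell t = openCell t' := by
  let e := (Equiv.ofInjective _ t.independent.injective).trans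
    ((Equiv.setCongr h).trans (Equiv.ofInjective _ t'.independent.injective).symm)
  have he : t.reindex e = t' := by
    ext1 k
    obtain ⟨l, rfl⟩ := e.surjective k
    have h1 : t'.points (e l) = t.points l :=
      Equiv.apply_ofInjective_symm t'.independent.injective _
    simp [Affine.Simplex.reindex, h1]
  rw [← he]
  exact (t.setInterior_reindex (Set.Ioi 0) e).symm

/-- Within the affine span the vertices are an affine basis, and the open cell is cut out by
finitely many strict inequalities on continuous barycentric coordinates. -/
theorem exists_isOpen_openCell_eq :
    ∃ U : Set (Space n), IsOpen U ∧
      openCell t = U ∩ (affineSpan ℝ (Set.range t.points) : Set (Space n)) := by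
  set A := affineSpan ℝ (Set.range t.points) with hAdef
  have : Nonempty A := Nonempty.map (AffineSubspace.inclusion le_rfl) inferInstance
  let s := t.restrict A le_rfl
  have htop : affineSpan ℝ (Set.range s.points) = ⊤ := by
    rw [s.independent.affineSpan_eq_top_iff_card_eq_finrank_add_one]
    simpa using (finrank_direction_affineSpan_points t).symm
  let b : AffineBasis (Fin (d + 1)) ℝ A := ⟨s.points, s.independent, htop⟩
  have hopen : IsOpen (s.setInterior (Set.Ioi 0)) := by
    have : s.setInterior (Set.Ioi 0) = ⋂ i, b.coord i ⁻¹' Set.Ioi (0 : ℝ) := by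
      ext x
      have hx := b.affineCombination_coord_eq_self x
      have h1 := b.sum_coord_apply_eq_one x
      rw [Set.mem_iInter]
      nth_rewrite 1 [← hx]
      exact Affine.Simplex.affineCombination_mem_setInterior_iff (s := s) h1
    rw [this]
    exact isOpen_iInter_of_finite fun i =>
      isOpen_Ioi.preimage (continuous_barycentric_coord b i)
  rw [t.setInterior_restrict (Set.Ioi 0) le_rfl, isOpen_induced_iff] at hopen
  obtain ⟨U, hU, h⟩ := hopen
  refine ⟨U, hU, ?_⟩
  ext x
  constructor
  · intro hx
    have hxA := openCell_subset_affineSpan t hx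
    have : (⟨x, hxA⟩ : A) ∈ (Subtype.val ⁻¹' U : Set A) := by rw [h]; exact hx
    exact ⟨this, hxA⟩
  · rintro ⟨hxU, hxA⟩
    have : (⟨x, hxA⟩ : A) ∈ (Subtype.val ⁻¹' U : Set A) := hxU
    rw [h] at this
    exact this

theorem measurableSet_openCell : MeasurableSet (openCell t) := by
  obtain ⟨U, hU, h⟩ := exists_isOpen_openCell_eq t
  rw [h]
  exact hU.measurableSet.inter (AffineSubspace.closed_of_finiteDimensional _).measurableSet

theorem hausdorff_openCell_pos : 0 < μHE[d] (openCell t) := by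
  obtain ⟨U, hU, h⟩ := exists_isOpen_openCell_eq t
  rw [h]
  exact hausdorff_pos (finrank_direction_affineSpan_points t) hU (h ▸ openCell_nonempty t)

theorem hausdorff_closedInterior_pos : 0 < μHE[d] t.closedInterior :=
  (hausdorff_openCell_pos t).trans_le (measure_mono (openCell_subset_closedInterior t))

theorem hausdorff_closedInterior_lt_top : μHE[d] t.closedInterior < ⊤ :=
  hausdorff_lt_top (finrank_direction_affineSpan_points t) t.closedInterior_subset_affineSpan
    t.isCompact_closedInterior.isBounded

instance isFiniteMeasure_restrict_closedInterior :
    IsFiniteMeasure ((μHE[d] : Measure (Space n)).restrict t.closedInterior) :=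
  ⟨by simpa using hausdorff_closedInterior_lt_top t⟩

theorem measurableSet_closedInterior : MeasurableSet t.closedInterior :=
  t.isClosed_closedInterior.measurableSet

theorem integrableOn_closedInterior {f : Space n → ℝ} (hf : Continuous f) :
    IntegrableOn f t.closedInterior μHE[d] := by
  obtain ⟨C, hC⟩ := t.isCompact_closedInterior.exists_bound_of_continuousOn hf.continuousOn
  exact Integrable.of_bound hf.aestronglyMeasurable C
    ((ae_restrict_iff' (measurableSet_closedInterior t)).2 (.of_forall hC))

/-- If `f` were nonzero at a point of the open cell, continuity would make it nonzero on a
relatively open set, which has positive measure. -/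
theorem eq_zero_of_integral_closedInterior_eq_zero {f : Space n → ℝ} (hf : Continuous f)
    (hnn : ∀ x, 0 ≤ f x) (h0 : ∫ x in t.closedInterior, f x ∂μHE[d] = 0) :
    ∀ x ∈ openCell t, f x = 0 := by
  intro x hx
  by_contra hne
  have hae := (setIntegral_eq_zero_iff_of_nonneg_ae (.of_forall hnn)
    (integrableOn_closedInterior t hf)).1 h0
  obtain ⟨U, hU, h⟩ := exists_isOpen_openCell_eq t
  have hV : IsOpen (U ∩ {y | f y ≠ 0}) := hU.inter (isOpen_ne_fun hf continuous_const)
  have hpos := hausdorff_pos (finrank_direction_affineSpan_points t) hV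
    ⟨x, ⟨(h ▸ hx : x ∈ U ∩ _).1, hne⟩, openCell_subset_affineSpan t hx⟩
  rw [Filter.EventuallyEq, ae_restrict_iff' (measurableSet_closedInterior t)] at hae
  refine hpos.ne' (measure_mono_null ?_ hae)
  rintro y ⟨⟨hyU, hy⟩, hyA⟩ hcon
  exact hy (hcon (openCell_subset_closedInterior t (h ▸ ⟨hyU, hyA⟩)))

end Simplex

/-! ### Raviart–Thomas functions on one simplex -/

section LocalRT

variable {n d : ℕ} {S : Submodule ℝ (Space n)}

theorem RT.eval_add (v w : RT S) (x : Space n) : (v + w).eval x = v.eval x + w.eval x := by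
  simp only [RT.eval, Prod.fst_add, Prod.snd_add, add_smul]
  abel

theorem RT.eval_smul (c : ℝ) (v : RT S) (x : Space n) : (c • v).eval x = c • v.eval x := by
  simp only [RT.eval, Prod.smul_fst, Prod.smul_snd, smul_assoc, smul_add]

theorem RT.continuous_eval (v : RT S) : Continuous v.eval := by
  unfold RT.eval
  fun_prop

/-- The normal components on all facets, as a linear map. -/
def RT.fluxMap (t : Affine.Simplex ℝ (Space n) (d + 1)) : RT S →ₗ[ℝ] (Fin (d + 2) → ℝ) where
  toFun v k := v.flux t k
  map_add' v w := by
    ext k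
    simp only [RT.flux, RT.eval_add, Submodule.coe_add, inner_add_left, Pi.add_apply]
  map_smul' c v := by
    ext k
    simp only [RT.flux, RT.eval_smul, Submodule.coe_smul, real_inner_smul_left, RingHom.id_apply,
      Pi.smul_apply, smul_eq_mul]

theorem RT.fluxMap_apply (t : Affine.Simplex ℝ (Space n) (d + 1)) (v : RT S) (k : Fin (d + 2)) :
    RT.fluxMap t v k = v.flux t k := rfl

variable (t : Affine.Simplex ℝ (Space n) (d + 1))

/-- Because the normal is tangential to the cell, the projection in `RT.eval` drops out of normal
components. -/
theorem outerNormal_mem (hS : (affineSpan ℝ (Set.range t.points)).direction = S)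
    (k : Fin (d + 2)) : outerNormal t k ∈ S := by
  rw [← hS]
  exact Submodule.smul_mem _ _ (AffineSubspace.vsub_mem_direction
    (t.altitudeFoot_mem_affineSpan k) (mem_affineSpan ℝ (Set.mem_range_self k)))

theorem RT.flux_basis (hS : (affineSpan ℝ (Set.range t.points)).direction = S)
    (k l : Fin (d + 2)) : (RT.basis S t k).flux t l = if l = k then 1 else 0 := by
  have hev : (RT.basis S t k).eval (t.altitudeFoot l) =
      (t.height k)⁻¹ • S.orthogonalProjectionOnto (t.altitudeFoot l - t.points k) := by
    simp only [RT.eval, RT.basis, map_sub, smul_sub]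
    abel
  have hin : inner ℝ ((S.orthogonalProjectionOnto (t.altitudeFoot l - t.points k) : S) : Space n)
      (outerNormal t l) = inner ℝ (t.altitudeFoot l - t.points k) (outerNormal t l) := by
    have := S.inner_orthogonalProjectionOnto_eq_of_mem_right ⟨_, outerNormal_mem t hS l⟩
      (t.altitudeFoot l - t.points k)
    simpa using this
  rw [RT.flux, hev, Submodule.coe_smul, real_inner_smul_left, hin, outerNormal,
    real_inner_smul_right]
  split_ifs with h
  · subst h
    have hh : t.height l ^ 2 = inner ℝ (t.altitudeFoot l - t.points l)
        (t.altitudeFoot l - t.points l) := by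
      rw [real_inner_self_eq_norm_sq, Affine.Simplex.height, dist_comm, dist_eq_norm]
    rw [← hh]
    have := (t.height_pos l).ne'
    field_simp
  -- For `l ≠ k` the vertex `k` lies on the facet opposite to `l`, so the vector from it to the foot
  -- of that altitude is orthogonal to the altitude.
  · have h0 := t.inner_vsub_altitudeFoot_vsub_altitudeFoot_eq_zero h
    simp only [vsub_eq_sub] at h0
    rw [← neg_sub (t.points k), ← neg_sub (t.points l), inner_neg_neg, h0, mul_zero, mul_zero]

theorem RT.flux_sum_basis (hS : (affineSpan ℝ (Set.range t.points)).direction = S)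
    (c : Fin (d + 2) → ℝ) (l : Fin (d + 2)) :
    (∑ k, c k • RT.basis S t k).flux t l = c l := by
  rw [← RT.fluxMap_apply, map_sum, Finset.sum_apply]
  simp only [map_smul, Pi.smul_apply]
  simp only [RT.fluxMap_apply, RT.flux_basis t hS, smul_eq_mul, mul_ite,
    mul_one, mul_zero, Finset.sum_ite_eq, Finset.mem_univ, if_true]

/-- By duality the flux map is surjective; both spaces have dimension `(d + 1) + 1 = d + 2`, so it
is injective, and the two sides have equal fluxes. -/
theorem RT.sum_flux_smul_basis (hS : (affineSpan ℝ (Set.range t.points)).direction = S)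
    (v : RT S) : ∑ k, v.flux t k • RT.basis S t k = v := by
  have hsurj : Function.Surjective (RT.fluxMap (S := S) t) := fun c =>
    ⟨∑ k, c k • RT.basis S t k, funext fun l => RT.flux_sum_basis t hS c l⟩
  have hdim : finrank ℝ (RT S) = finrank ℝ (Fin (d + 2) → ℝ) := by
    have := finrank_direction_affineSpan_points t
    rw [hS] at this
    simp [Module.finrank_prod, this]
  refine (LinearMap.injective_iff_surjective_of_finrank_eq_finrank hdim).2 hsurj ?_
  ext l
  rw [RT.fluxMap_apply, RT.flux_sum_basis t hS, RT.fluxMap_apply]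

/-- Comparing the field `a + b P x` at two points of the open cell that differ by a small multiple
of an edge gives `b = 0`; then `a = 0`. -/
theorem RT.eq_zero_of_eval_eq_zero (hS : (affineSpan ℝ (Set.range t.points)).direction = S)
    {v : RT S} (hv : ∀ x ∈ openCell t, v.eval x = 0) : v = 0 := by
  obtain ⟨x, hx⟩ := openCell_nonempty t
  obtain ⟨U, hU, h⟩ := exists_isOpen_openCell_eq t
  set e : Space n := t.points 0 - t.points 1
  have he : e ∈ S := hS ▸ AffineSubspace.vsub_mem_direction
    (mem_affineSpan ℝ (Set.mem_range_self 0)) (mem_affineSpan ℝ (Set.mem_range_self 1))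
  have he0 : e ≠ 0 := sub_ne_zero.2 (t.independent.injective.ne (by simp))
  have hev : ∀ᶠ s in 𝓝 (0 : ℝ), x + s • e ∈ U := by
    have hc : Continuous fun s : ℝ => x + s • e := by fun_prop
    refine hc.continuousAt.eventually_mem (hU.mem_nhds ?_)
    simpa using (h ▸ hx : x ∈ U ∩ _).1
  obtain ⟨s, hsU, hs⟩ := ((hev.filter_mono nhdsWithin_le_nhds).and
    (self_mem_nhdsWithin : Set.Ioi (0 : ℝ) ∈ 𝓝[>] 0)).exists
  have hs0 : s ≠ 0 := ne_of_gt hs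
  have hmem : x + s • e ∈ openCell t := by
    rw [h]
    refine ⟨hsU, ?_⟩
    have := AffineSubspace.vadd_mem_of_mem_direction (hS ▸ S.smul_mem s he)
      (openCell_subset_affineSpan t hx)
    rwa [vadd_eq_add, add_comm (s • e) x] at this
  have h1 := hv x hx
  have h2 := hv _ hmem
  have h3 : v.2 • s • S.orthogonalProjectionOnto e = 0 := by
    have h4 : v.eval (x + s • e) = v.eval x + v.2 • s • S.orthogonalProjectionOnto e := by
      simp only [RT.eval, map_add, map_smul, smul_add, add_assoc]
    rwa [h2, h1, zero_add, eq_comm] at h4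
  have hpe : S.orthogonalProjectionOnto e ≠ 0 := by
    have := S.orthogonalProjectionOnto_mem_subspace_eq_self ⟨e, he⟩
    intro h0
    rw [h0] at this
    exact he0 (congrArg Subtype.val this).symm
  have hv2 : v.2 = 0 := by
    rcases smul_eq_zero.1 h3 with h | h
    · exact h
    · exact absurd h (smul_ne_zero hs0 hpe)
  refine Prod.ext ?_ hv2
  simpa [RT.eval, hv2] using h1

end LocalRT

/-! ### Linear algebra of semidefinite and definite bilinear forms -/

/-- `B(∑ xₖ, ∑ xₖ) ≤ N ∑ B(xₖ, xₖ)` for a positive semidefinite bilinear form. -/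
theorem apply_sum_self_le {E ι : Type*} [AddCommGroup E] [Module ℝ E] [Fintype ι]
    (B : E →ₗ[ℝ] E →ₗ[ℝ] ℝ) (hB : ∀ x, 0 ≤ B x x) (x : ι → E) :
    B (∑ k, x k) (∑ k, x k) ≤ Fintype.card ι * ∑ k, B (x k) (x k) := by
  -- Expanding over all pairs gives `2N ∑ B(xₖ, xₖ) - 2 B(∑ xₖ, ∑ xₖ)`. The mixed terms agree after
  -- swapping the indices, so symmetry of `B` is not needed.
  have h : 0 ≤ ∑ k, ∑ l, B (x k - x l) (x k - x l) :=
    Finset.sum_nonneg fun k _ => Finset.sum_nonneg fun l _ => hB _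
  have e1 : B (∑ k, x k) (∑ k, x k) = ∑ k, ∑ l, B (x k) (x l) := by
    simp [map_sum, LinearMap.sum_apply]
    rw [Finset.sum_comm]
  have e2 : ∑ k, ∑ l, B (x k - x l) (x k - x l) =
      2 * (Fintype.card ι * ∑ k, B (x k) (x k)) - 2 * ∑ k, ∑ l, B (x k) (x l) := by
    simp only [map_sub, LinearMap.sub_apply, Finset.sum_sub_distrib, Finset.sum_const,
      Finset.card_univ, nsmul_eq_mul, Finset.mul_sum]
    rw [Finset.sum_comm (f := fun k l => B (x l) (x k))]
    simp only [← Finset.mul_sum]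
    ring
  linarith

/-- A definite bilinear form on a finite-dimensional space identifies the space with its dual. -/
theorem existsUnique_linearMap_of_definite {E F : Type*} [AddCommGroup E] [Module ℝ E]
    [FiniteDimensional ℝ E] [AddCommGroup F] [Module ℝ F] (B : E →ₗ[ℝ] E →ₗ[ℝ] ℝ)
    (hB : ∀ x, B x x = 0 → x = 0) (b : F →ₗ[ℝ] E →ₗ[ℝ] ℝ) :
    ∃! D : F →ₗ[ℝ] E, ∀ q r, B (D q) r = b q r := by
  have hinj : Function.Injective B := by
    rw [← LinearMap.ker_eq_bot, LinearMap.ker_eq_bot']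
    intro x hx
    exact hB x (by rw [hx, LinearMap.zero_apply])
  let e : E ≃ₗ[ℝ] (E →ₗ[ℝ] ℝ) :=
    LinearMap.linearEquivOfInjective B hinj (Subspace.dual_finrank_eq (K := ℝ) (V := E)).symm
  have he : ∀ x, e x = B x := fun x => rfl
  refine ⟨e.symm.toLinearMap ∘ₗ b, fun q r => ?_, fun D hD => ?_⟩
  · rw [← he]
    simp
  · ext1 q
    apply hinj
    ext r
    rw [hD, ← he]
    simp

/-! ### Piecewise constant functions on a triangulation -/

namespace Triangulation

variable {n d : ℕ} {S : Set (Space n)} (T : Triangulation d S)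

theorem closedInterior_cell_subset (τ : T.ι) : (T.cell τ).closedInterior ⊆ closure S := by
  rw [← T.iUnion_cell]
  exact Set.subset_iUnion (fun τ => (T.cell τ).closedInterior) τ

include T in
theorem isBounded : Bornology.IsBounded S := by
  refine Bornology.IsBounded.subset ?_ (T.iUnion_cell ▸ subset_closure : S ⊆ _)
  exact Bornology.isBounded_iUnion.2 fun τ => (T.cell τ).isCompact_closedInterior.isBounded

theorem toFun_add (c c' : T.ι → ℝ) (x : Space n) :
    T.toFun (c + c') x = T.toFun c x + T.toFun c' x := by
  classical
  simp only [toFun, ← Finset.sum_add_distrib, Set.indicator_apply, Pi.add_apply]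
  exact Finset.sum_congr rfl fun τ _ => by split_ifs <;> simp

theorem toFun_smul (a : ℝ) (c : T.ι → ℝ) (x : Space n) :
    T.toFun (a • c) x = a * T.toFun c x := by
  classical
  simp only [toFun, Finset.mul_sum, Set.indicator_apply, Pi.smul_apply, smul_eq_mul]
  exact Finset.sum_congr rfl fun τ _ => by split_ifs <;> simp

theorem measurable_toFun (c : T.ι → ℝ) : Measurable (T.toFun c) := by
  unfold toFun
  exact Finset.measurable_sum _ fun τ _ =>
    measurable_const.indicator (measurableSet_openCell (T.cell τ))

theorem norm_toFun_le (c : T.ι → ℝ) (x : Space n) : ‖T.toFun c x‖ ≤ ∑ τ, ‖c τ‖ :=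
  (norm_sum_le _ _).trans (Finset.sum_le_sum fun _ _ => norm_indicator_le_norm_self _ _)

theorem integrable_toFun (c : T.ι → ℝ) (m : Measure (Space n)) [IsFiniteMeasure m] :
    Integrable (T.toFun c) m :=
  Integrable.of_bound (T.measurable_toFun c).aestronglyMeasurable _
    (.of_forall (T.norm_toFun_le c))

end Triangulation

/-! ### Cells and subdomains -/

theorem Decomposition.dom_subset_aff {n : ℕ} (G : Decomposition n) (d : ℕ) (i : G.I d) :
    G.dom d i ⊆ G.aff d i := by
  obtain ⟨U, -, h⟩ := G.dom_relOpen d i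
  rw [h]
  exact Set.inter_subset_right

section Geometry

variable {n : ℕ} {G : Geometry n} {d : ℕ} {i : G.I d}

/-- The vertices lie in the closure of the subdomain, hence in its closed plane, and the dimensions
agree. This makes the single-simplex results available on every cell. -/
theorem Triangulation.direction_cell (T : Triangulation d (G.dom d i)) (τ : T.ι) :
    (affineSpan ℝ (Set.range (T.cell τ).points)).direction = G.dir d i := by
  have hle : affineSpan ℝ (Set.range (T.cell τ).points) ≤ G.aff d i := by
    rw [affineSpan_le]
    rintro _ ⟨k, rfl⟩
    exact closure_minimal (G.dom_subset_aff d i) (AffineSubspace.closed_of_finiteDimensional _)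
      (T.closedInterior_cell_subset τ ((T.cell τ).point_mem_closedInterior k))
  exact Submodule.eq_of_le_of_finrank_eq (AffineSubspace.direction_le hle)
    ((finrank_direction_affineSpan_points _).trans (G.finrank_aff d i).symm)

theorem Triangulation.isFiniteMeasure_restrict_dom (T : Triangulation d (G.dom d i)) :
    IsFiniteMeasure ((μHE[d] : Measure (Space n)).restrict (G.dom d i)) :=
  ⟨by simpa using hausdorff_lt_top (G.finrank_aff d i) (G.dom_subset_aff d i) T.isBounded⟩

end Geometry

namespace Mesh

variable {n : ℕ} {G : Geometry n} {M : Mesh G} (P : Params G)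

/-! ### The local forms `(K⁻¹ u, v)_T` -/

section Cell

variable {d : ℕ} (i : G.I (d + 1)) (t : (M.sub (d + 1) i).ι)

theorem continuous_inner_eval (u v : RT (G.dir (d + 1) i)) :
    Continuous fun x => (inner ℝ ((P.K (d + 1) i).symm (u.eval x)) (v.eval x) : ℝ) :=
  ((LinearMap.continuous_of_finiteDimensional
    (P.K (d + 1) i).symm.toLinearMap).comp u.continuous_eval).inner v.continuous_eval

/-- `(K⁻¹ u, v)_T` as a bilinear form. -/
def formCellMap : RT (G.dir (d + 1) i) →ₗ[ℝ] RT (G.dir (d + 1) i) →ₗ[ℝ] ℝ :=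
  have hi u v := integrableOn_closedInterior ((M.sub (d + 1) i).cell t)
    (continuous_inner_eval P i u v)
  LinearMap.mk₂ ℝ (formCell P i t)
    (fun u u' v => by
      simp only [formCell, RT.eval_add, map_add, inner_add_left]
      exact integral_add (hi u v) (hi u' v))
    (fun c u v => by
      simp only [formCell, RT.eval_smul, map_smul, smul_eq_mul]
      rw [← integral_const_mul]
      exact integral_congr_ae (.of_forall fun x => by
        simp only [Submodule.coe_inner, Submodule.coe_smul, real_inner_smul_left]))
    (fun u v v' => by
      simp only [formCell, RT.eval_add, inner_add_right]
      exact integral_add (hi u v) (hi u v'))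
    (fun c u v => by
      simp only [formCell, RT.eval_smul, smul_eq_mul]
      rw [← integral_const_mul]
      exact integral_congr_ae (.of_forall fun x => by
        simp only [Submodule.coe_inner, Submodule.coe_smul, real_inner_smul_right]))

theorem formCellMap_apply (u v : RT (G.dir (d + 1) i)) :
    formCellMap P i t u v = formCell P i t u v := rfl

theorem inner_symm_self_pos {d : ℕ} {i : G.I d} {u : G.dir d i} (hu : u ≠ 0) :
    0 < (inner ℝ ((P.K d i).symm u) u : ℝ) := by
  have h := P.K_pos d i ((P.K d i).symm u) (by simpa using hu)
  rwa [LinearEquiv.apply_symm_apply, real_inner_comm] at h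

theorem inner_symm_self_nonneg {d : ℕ} {i : G.I d} (u : G.dir d i) :
    0 ≤ (inner ℝ ((P.K d i).symm u) u : ℝ) := by
  rcases eq_or_ne u 0 with rfl | hu
  · simp
  · exact (inner_symm_self_pos P hu).le

theorem formCell_self_nonneg (u : RT (G.dir (d + 1) i)) : 0 ≤ formCell P i t u u :=
  integral_nonneg fun _ => inner_symm_self_nonneg P _

theorem eq_zero_of_formCell_self_eq_zero {u : RT (G.dir (d + 1) i)}
    (h : formCell P i t u u = 0) : u = 0 := by
  refine RT.eq_zero_of_eval_eq_zero _ ((M.sub (d + 1) i).direction_cell t) fun x hx => ?_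
  by_contra hne
  exact (inner_symm_self_pos P hne).ne' (eq_zero_of_integral_closedInterior_eq_zero _
    (continuous_inner_eval P i u u) (fun _ => inner_symm_self_nonneg P _) h x hx)

/-- On a simplex, `(K⁻¹ u, u)_T` is at most `d + 2` times its diagonal part. -/
theorem formCell_self_le (u : RT (G.dir (d + 1) i)) :
    formCell P i t u u ≤ (d + 2 : ℕ) * ∑ k, u.flux ((M.sub (d + 1) i).cell t) k *
      u.flux ((M.sub (d + 1) i).cell t) k *
      formCell P i t (RT.basis (G.dir (d + 1) i) ((M.sub (d + 1) i).cell t) k)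
        (RT.basis (G.dir (d + 1) i) ((M.sub (d + 1) i).cell t) k) := by
  have h := apply_sum_self_le (formCellMap P i t) (formCell_self_nonneg P i t) fun k =>
    u.flux ((M.sub (d + 1) i).cell t) k •
      RT.basis (G.dir (d + 1) i) ((M.sub (d + 1) i).cell t) k
  rw [RT.sum_flux_smul_basis _ ((M.sub (d + 1) i).direction_cell t)] at h
  simpa only [formCellMap_apply, map_smul, LinearMap.smul_apply, smul_eq_mul, Fintype.card_fin,
    mul_assoc] using h

end Cell

/-! ### The interface form -/

/-- The weight `∫_τ γ K_ν⁻¹` of a mortar cell. -/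
def mortarWeight {d : ℕ} (i : G.I d) (j : G.J d i) (τ : (M.mortar d i j).ι) : ℝ :=
  ∫ x in ((M.mortar d i j).cell τ).closedInterior, P.γ d i j * (P.Kν d i j x)⁻¹ ∂μHE[d]

/-- The lower bound on `K_ν` makes the positive integrand bounded, hence integrable, and the cell
has positive measure. -/
theorem mortarWeight_pos {d : ℕ} (i : G.I d) (j : G.J d i) (τ : (M.mortar d i j).ι) :
    0 < mortarWeight P i j τ := by
  obtain ⟨m, C, hm, hK⟩ := P.Kν_bounds d i j
  have hγ := P.γ_pos d i j
  have hsub := (M.mortar d i j).closedInterior_cell_subset τ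
  have hpos : ∀ x ∈ ((M.mortar d i j).cell τ).closedInterior, 0 < P.Kν d i j x := fun x hx =>
    hm.trans_le (hK x (hsub hx)).1
  have hms := measurableSet_closedInterior ((M.mortar d i j).cell τ)
  have hint : IntegrableOn (fun x => P.γ d i j * (P.Kν d i j x)⁻¹)
      ((M.mortar d i j).cell τ).closedInterior μHE[d] := by
    refine Integrable.of_bound
      ((P.Kν_measurable d i j).inv.const_mul _).aestronglyMeasurable (P.γ d i j * m⁻¹)
      ((ae_restrict_iff' hms).2 (.of_forall fun x hx => ?_))
    rw [Real.norm_of_nonneg (mul_nonneg hγ.le (inv_nonneg.2 (hpos x hx).le))]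
    exact mul_le_mul_of_nonneg_left (inv_anti₀ hm (hK x (hsub hx)).1) hγ.le
  rw [mortarWeight, setIntegral_pos_iff_support_of_nonneg_ae
    ((ae_restrict_iff' hms).2 (.of_forall fun x hx =>
      mul_nonneg hγ.le (inv_nonneg.2 (hpos x hx).le))) hint]
  have hsupp : ((M.mortar d i j).cell τ).closedInterior ⊆
      Function.support fun x => P.γ d i j * (P.Kν d i j x)⁻¹ := fun x hx =>
    (mul_pos hγ (inv_pos.2 (hpos x hx))).ne'
  rw [Set.inter_eq_self_of_subset_right hsupp]
  exact hausdorff_closedInterior_pos _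

/-- Mortar functions are constant on cells, so the form is diagonal with positive weights; its
algebraic properties can be read off. -/
theorem formΓ_eq (l m : M.L) :
    formΓ P l m = ∑ d : Fin n, ∑ i : G.I d, ∑ j : G.J d i, ∑ τ : (M.mortar d i j).ι,
      mortarWeight P i j τ * l d i j τ * m d i j τ := by
  simp only [formΓ, mortarWeight, integral_mul_const]

end Mesh

namespace Mesh

variable {n : ℕ} {G : Geometry n} {M : Mesh G}

theorem flux_add {d : ℕ} (v w : M.Xd d) (i : G.I (d + 1)) (t : (M.sub (d + 1) i).ι)
    (k : Fin (d + 2)) : flux (v + w) i t k = flux v i t k + flux w i t k :=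
  congrFun (map_add (RT.fluxMap ((M.sub (d + 1) i).cell t)) (v i t) (w i t)) k

theorem flux_smul {d : ℕ} (c : ℝ) (v : M.Xd d) (i : G.I (d + 1)) (t : (M.sub (d + 1) i).ι)
    (k : Fin (d + 2)) : flux (c • v) i t k = c * flux v i t k :=
  congrFun (map_smul (RT.fluxMap ((M.sub (d + 1) i).cell t)) c (v i t)) k

/-! ### Existence of the discrete extension operator -/

section Extension

variable {d : ℕ}

open Classical in
/-- The mean of `μ` over the facet `(t, k)` if this facet lies on an interface, zero otherwise. -/
def facetMean (μ : M.Ld d) (i' : G.I (d + 1)) (t : (M.sub (d + 1) i').ι) (k : Fin (d + 2)) : ℝ :=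
  ∑ i : G.I d, ∑ j : G.J d i,
    if G.up d i j = i' ∧ openCell (M.fct i' t k) ⊆ G.dom d i ∧
      outerNormal ((M.sub (d + 1) i').cell t) k = G.normal d i j then
      ⨍ x in (M.fct i' t k).closedInterior, (M.mortar d i j).toFun (μ i j) x ∂μHE[d]
    else 0

theorem facetMean_add (μ μ' : M.Ld d) (i' : G.I (d + 1)) (t : (M.sub (d + 1) i').ι)
    (k : Fin (d + 2)) : facetMean (μ + μ') i' t k = facetMean μ i' t k + facetMean μ' i' t k := by
  simp only [facetMean, ← Finset.sum_add_distrib]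
  refine Finset.sum_congr rfl fun i _ => Finset.sum_congr rfl fun j _ => ?_
  split_ifs
  · simp only [setAverage_eq, Pi.add_apply, Triangulation.toFun_add]
    rw [integral_add (Triangulation.integrable_toFun _ _ _)
      (Triangulation.integrable_toFun _ _ _), smul_add]
  · rw [add_zero]

theorem facetMean_smul (c : ℝ) (μ : M.Ld d) (i' : G.I (d + 1)) (t : (M.sub (d + 1) i').ι)
    (k : Fin (d + 2)) : facetMean (c • μ) i' t k = c * facetMean μ i' t k := by
  simp only [facetMean, Finset.mul_sum]
  refine Finset.sum_congr rfl fun i _ => Finset.sum_congr rfl fun j _ => ?_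
  split_ifs
  · simp only [setAverage_eq, Pi.smul_apply, Triangulation.toFun_smul, smul_eq_mul]
    rw [integral_const_mul]
    ring
  · rw [mul_zero]

theorem facetMean_eq_zero (μ : M.Ld d) {i' : G.I (d + 1)} {t : (M.sub (d + 1) i').ι}
    {k : Fin (d + 2)} (h : ∀ i : G.I d, ¬ openCell (M.fct i' t k) ⊆ G.dom d i) :
    facetMean μ i' t k = 0 :=
  Finset.sum_eq_zero fun i _ => Finset.sum_eq_zero fun _ _ => if_neg fun hc => h i hc.2.1

/-- Subdomains of different dimensions are disjoint, so such a facet lies on no interface. This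
gives normal continuity of the extension inside a subdomain. -/
theorem facetMean_of_subset_dom (μ : M.Ld d) {i' i'' : G.I (d + 1)} {t : (M.sub (d + 1) i').ι}
    {k : Fin (d + 2)} (h : openCell (M.fct i' t k) ⊆ G.dom (d + 1) i'') :
    facetMean μ i' t k = 0 := by
  refine facetMean_eq_zero μ fun i hi => ?_
  obtain ⟨x, hx⟩ := openCell_nonempty (M.fct i' t k)
  have hne : (⟨d + 1, i''⟩ : Σ d, G.I d) ≠ ⟨d, i⟩ := fun he => by
    have := congrArg Sigma.fst he
    simp at this
  exact Set.disjoint_left.1 (G.dom_disjoint hne) (h hx) (hi hx)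

/-- `Ω` is open, so its frontier meets no subdomain. -/
theorem facetMean_of_subset_boundary (μ : M.Ld d) {i' : G.I (d + 1)}
    {t : (M.sub (d + 1) i').ι} {k : Fin (d + 2)}
    (h : openCell (M.fct i' t k) ⊆ G.bdD ∪ G.bdN) : facetMean μ i' t k = 0 := by
  refine facetMean_eq_zero μ fun i hi => ?_
  obtain ⟨x, hx⟩ := openCell_nonempty (M.fct i' t k)
  have hfr := h hx
  rw [G.bd_union, G.omega_open.frontier_eq] at hfr
  exact hfr.2 (Set.mem_iUnion.2 ⟨d, Set.mem_iUnion.2 ⟨i, hi hx⟩⟩)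

/-- Only one term of the double sum survives: disjointness of the subdomains determines `i`, and
`side_unique` determines `j` from the adjacent subdomain and the normal. -/
theorem facetMean_of_onInterface (μ : M.Ld d) {i : G.I d} {j : G.J d i}
    {t : (M.sub (d + 1) (G.up d i j)).ι} {k : Fin (d + 2)} (h : M.OnInterface i j t k) :
    facetMean μ (G.up d i j) t k =
      ⨍ x in (M.fct (G.up d i j) t k).closedInterior,
        (M.mortar d i j).toFun (μ i j) x ∂μHE[d] := by
  obtain ⟨x, hx⟩ := openCell_nonempty (M.fct (G.up d i j) t k)
  rw [facetMean, Finset.sum_eq_single i, Finset.sum_eq_single j, if_pos ⟨rfl, h⟩]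
  · intro j' _ hj'
    refine if_neg fun hc => hj' ?_
    exact (G.side_unique d i x (h.1 hx) (G.up d i j) (G.normal d i j) (G.normal_unit d i j)
      (G.normal_orth d i j) (G.normal_side d i j x (h.1 hx))).unique
      ⟨hc.1, hc.2.2.symm.trans h.2⟩ ⟨rfl, rfl⟩
  · simp
  · intro i₁ _ hi₁
    refine Finset.sum_eq_zero fun j' _ => if_neg fun hc => ?_
    have hne : (⟨d, i₁⟩ : Σ d, G.I d) ≠ ⟨d, i⟩ := fun he => hi₁ (by simpa using he)
    exact Set.disjoint_left.1 (G.dom_disjoint hne) (hc.2.1 hx) (h.1 hx)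
  · simp

/-- The field whose normal component is `facetMean μ` on each facet. -/
def extensionField (μ : M.Ld d) : M.Xd d := fun i t =>
  ∑ k, facetMean μ i t k • RT.basis (G.dir (d + 1) i) ((M.sub (d + 1) i).cell t) k

theorem flux_extensionField (μ : M.Ld d) (i : G.I (d + 1)) (t : (M.sub (d + 1) i).ι)
    (k : Fin (d + 2)) : flux (extensionField μ) i t k = facetMean μ i t k :=
  RT.flux_sum_basis _ ((M.sub (d + 1) i).direction_cell t) _ k

theorem extensionField_mem (μ : M.Ld d) : extensionField μ ∈ M.Vd d := by
  refine ⟨fun i t t' k k' _ hr h => ?_, fun i t k h => ?_⟩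
  · have heq : openCell (M.fct i t' k') ⊆ G.dom (d + 1) i := openCell_eq_of_range_eq hr ▸ h
    rw [flux_extensionField, flux_extensionField, facetMean_of_subset_dom μ h,
      facetMean_of_subset_dom μ heq, add_zero]
  · rw [flux_extensionField]
    exact facetMean_of_subset_boundary μ (h.trans Set.subset_union_right)

/-- The discrete extension by facet means. -/
def extension (d : ℕ) : M.Ld d →ₗ[ℝ] M.Vd d where
  toFun μ := ⟨extensionField μ, extensionField_mem μ⟩
  map_add' μ μ' := by
    ext1
    funext i t
    simp only [extensionField, facetMean_add, add_smul, Finset.sum_add_distrib, Submodule.coe_add,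
      Pi.add_apply]
  map_smul' c μ := by
    ext1
    funext i t
    simp only [extensionField, facetMean_smul, mul_smul, Finset.smul_sum, Submodule.coe_smul,
      Pi.smul_apply, RingHom.id_apply]

/-- Normal traces are constant on each facet, so the orthogonality holds facet by facet: a function
minus its mean integrates to zero. -/
theorem isExtension_extension (d : ℕ) : M.IsExtension d (extension d) := by
  refine ⟨fun μ v => ?_, fun μ i t k h => ?_⟩
  · refine Finset.sum_eq_zero fun i _ => Finset.sum_eq_zero fun j _ =>
      Finset.sum_eq_zero fun t _ => Finset.sum_eq_zero fun k _ => ?_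
    split_ifs with h
    · have hf : flux (extension d μ : M.Xd d) (G.up d i j) t k = _ :=
        (flux_extensionField μ (G.up d i j) t k).trans (facetMean_of_onInterface μ h)
      rw [integral_mul_const, hf]
      refine mul_eq_zero_of_left ?_ _
      rw [integral_sub (integrable_const _) (Triangulation.integrable_toFun _ _ _),
        integral_const, setAverage_eq, measureReal_restrict_apply_univ, smul_smul,
        mul_inv_cancel₀, one_smul, sub_self]
      exact (ENNReal.toReal_pos (hausdorff_closedInterior_pos _).ne'
        (hausdorff_closedInterior_lt_top _).ne).ne'
    · rfl
  · exact (flux_extensionField μ i t k).trans (facetMean_of_subset_boundary μ h)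

end Extension

end Mesh

namespace Mesh

variable {n : ℕ} {G : Geometry n} {M : Mesh G} (P : Params G)
  (R : ∀ d : Fin n, M.Ld d →ₗ[ℝ] M.Vd d)

/-! ### The global forms -/

theorem total_add (w r : M.W) (d : Fin n) : total R (w + r) d = total R w d + total R r d := by
  simp only [total, Prod.fst_add, Prod.snd_add, Pi.add_apply, map_add, Submodule.coe_add]
  abel

theorem total_smul (c : ℝ) (r : M.W) (d : Fin n) : total R (c • r) d = c • total R r d := by
  simp only [total, Prod.smul_fst, Prod.smul_snd, Pi.smul_apply, map_smul, Submodule.coe_smul,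
    smul_add]

theorem formΓ_comm (l m : M.L) : formΓ P l m = formΓ P m l := by
  simp only [formΓ_eq, mul_right_comm]

theorem formΓ_add_left (l l' m : M.L) : formΓ P (l + l') m = formΓ P l m + formΓ P l' m := by
  simp only [formΓ_eq, Pi.add_apply, mul_add, add_mul, Finset.sum_add_distrib]

theorem formΓ_smul_left (c : ℝ) (l m : M.L) : formΓ P (c • l) m = c * formΓ P l m := by
  simp only [formΓ_eq, Pi.smul_apply, smul_eq_mul, Finset.mul_sum]
  simp only [mul_left_comm, mul_assoc]

theorem mortarWeight_mul_self_nonneg (m : M.L) {d : Fin n} (i : G.I d) (j : G.J d i)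
    (τ : (M.mortar d i j).ι) : 0 ≤ mortarWeight P i j τ * m d i j τ * m d i j τ := by
  rw [mul_assoc]
  exact mul_nonneg (mortarWeight_pos P i j τ).le (mul_self_nonneg _)

theorem formΓ_self_nonneg (m : M.L) : 0 ≤ formΓ P m m := by
  rw [formΓ_eq]
  exact Finset.sum_nonneg fun d _ => Finset.sum_nonneg fun i _ => Finset.sum_nonneg fun j _ =>
    Finset.sum_nonneg fun τ _ => mortarWeight_mul_self_nonneg P m i j τ

theorem eq_zero_of_formΓ_self_eq_zero {m : M.L} (h : formΓ P m m = 0) : m = 0 := by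
  rw [formΓ_eq] at h
  have hn {d : Fin n} (i : G.I d) (j : G.J d i) := mortarWeight_mul_self_nonneg P m i j
  funext d i j τ
  have h1 := (Finset.sum_eq_zero_iff_of_nonneg fun d _ => Finset.sum_nonneg fun i _ =>
    Finset.sum_nonneg fun j _ => Finset.sum_nonneg fun τ _ => hn i j τ).1 h d (Finset.mem_univ _)
  have h2 := (Finset.sum_eq_zero_iff_of_nonneg fun i _ =>
    Finset.sum_nonneg fun j _ => Finset.sum_nonneg fun τ _ => hn i j τ).1 h1 i (Finset.mem_univ _)
  have h3 := (Finset.sum_eq_zero_iff_of_nonneg fun j _ => Finset.sum_nonneg fun τ _ =>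
    hn i j τ).1 h2 j (Finset.mem_univ _)
  have h4 := (Finset.sum_eq_zero_iff_of_nonneg fun τ _ => hn i j τ).1 h3 τ (Finset.mem_univ _)
  rw [mul_assoc] at h4
  exact mul_self_eq_zero.1 ((mul_eq_zero.1 h4).resolve_left (mortarWeight_pos P i j τ).ne')

theorem a_self_nonneg (r : M.W) : 0 ≤ a P R r r :=
  add_nonneg (Finset.sum_nonneg fun _ _ => Finset.sum_nonneg fun i _ => Finset.sum_nonneg fun t _ =>
    formCell_self_nonneg P i t _) (formΓ_self_nonneg P _)

theorem eq_zero_of_a_self_eq_zero {r : M.W} (h : a P R r r = 0) : r = 0 := by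
  have hn (d : Fin n) (i : G.I ((d : ℕ) + 1)) (t : (M.sub ((d : ℕ) + 1) i).ι) :=
    formCell_self_nonneg P i t (total R r d i t)
  have hS : 0 ≤ ∑ d : Fin n, ∑ i : G.I ((d : ℕ) + 1), ∑ t : (M.sub ((d : ℕ) + 1) i).ι,
      formCell P i t (total R r d i t) (total R r d i t) :=
    Finset.sum_nonneg fun d _ => Finset.sum_nonneg fun i _ => Finset.sum_nonneg fun t _ => hn d i t
  have hΓ := formΓ_self_nonneg P r.2
  rw [a] at h
  -- Both nonnegative parts of `a` vanish. With `λ = 0` the extension disappears, and the total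
  -- field is `u₀` itself.
  have h2 : r.2 = 0 := eq_zero_of_formΓ_self_eq_zero P (by linarith)
  have h0 : ∑ d : Fin n, ∑ i : G.I ((d : ℕ) + 1), ∑ t : (M.sub ((d : ℕ) + 1) i).ι,
      formCell P i t (total R r d i t) (total R r d i t) = 0 := by linarith
  refine Prod.ext ?_ h2
  funext d
  ext1
  funext i t
  have h3 := (Finset.sum_eq_zero_iff_of_nonneg fun d _ => Finset.sum_nonneg fun i _ =>
    Finset.sum_nonneg fun t _ => hn d i t).1 h0 d (Finset.mem_univ _)
  have h4 := (Finset.sum_eq_zero_iff_of_nonneg fun i _ =>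
    Finset.sum_nonneg fun t _ => hn d i t).1 h3 i (Finset.mem_univ _)
  have h5 := (Finset.sum_eq_zero_iff_of_nonneg fun t _ => hn d i t).1 h4 t (Finset.mem_univ _)
  have h6 := eq_zero_of_formCell_self_eq_zero P i t h5
  have h7 : total R r d = (r.1 d : M.Xd d) := by
    rw [total, h2, Pi.zero_apply, map_zero, Submodule.coe_zero, add_zero]
  rwa [h7] at h6

/-- `a(r, r)` is at most `n + 1` times its diagonal counterpart. -/
theorem a_self_le (r : M.W) : a P R r r ≤ (n + 1 : ℕ) * aD P R r r := by
  have hΓ := formΓ_self_nonneg P r.2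
  have hn (d : Fin n) (i : G.I ((d : ℕ) + 1)) (t : (M.sub ((d : ℕ) + 1) i).ι) :
      formCell P i t (total R r d i t) (total R r d i t) ≤ (n + 1 : ℕ) *
        ∑ k : Fin ((d : ℕ) + 2), flux (total R r d) i t k * flux (total R r d) i t k *
        formCell P i t (RT.basis (G.dir (d + 1) i) ((M.sub (d + 1) i).cell t) k)
          (RT.basis (G.dir (d + 1) i) ((M.sub (d + 1) i).cell t) k) := by
    refine (formCell_self_le P i t _).trans (mul_le_mul_of_nonneg_right ?_
      (Finset.sum_nonneg fun k _ => mul_nonneg (mul_self_nonneg _)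
        (formCell_self_nonneg P i t _)))
    -- A cell of dimension `d + 1 ≤ n` has `d + 2` facets.
    exact_mod_cast (by omega : (d : ℕ) + 2 ≤ n + 1)
  rw [a, aD, mul_add]
  refine add_le_add ?_ (le_mul_of_one_le_left hΓ (by simp))
  simp only [Finset.mul_sum (s := (Finset.univ : Finset (Fin n)))]
  refine Finset.sum_le_sum fun d _ => ?_
  rw [Finset.mul_sum]
  refine Finset.sum_le_sum fun i _ => ?_
  rw [Finset.mul_sum]
  exact Finset.sum_le_sum fun t _ => hn d i t

theorem aD_comm (w r : M.W) : aD P R w r = aD P R r w := by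
  unfold aD
  rw [formΓ_comm]
  congr 1
  refine Finset.sum_congr rfl fun d _ => Finset.sum_congr rfl fun i _ =>
    Finset.sum_congr rfl fun t _ => Finset.sum_congr rfl fun k _ => ?_
  ring

theorem aD_add_left (w w' r : M.W) : aD P R (w + w') r = aD P R w r + aD P R w' r := by
  unfold aD
  rw [Prod.snd_add, formΓ_add_left]
  simp only [total_add, flux_add, add_mul, Finset.sum_add_distrib]
  ring

theorem aD_smul_left (c : ℝ) (w r : M.W) : aD P R (c • w) r = c * aD P R w r := by
  unfold aD
  rw [Prod.smul_snd, formΓ_smul_left]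
  simp only [total_smul, flux_smul, mul_assoc, ← Finset.mul_sum, ← mul_add]

/-- `a^D` as a bilinear form. -/
def aDMap : M.W →ₗ[ℝ] M.W →ₗ[ℝ] ℝ :=
  LinearMap.mk₂ ℝ (aD P R) (aD_add_left P R) (aD_smul_left P R)
    (fun w r r' => by rw [aD_comm, aD_add_left, aD_comm P R r, aD_comm P R r'])
    (fun c w r => by rw [aD_comm, aD_smul_left, aD_comm P R r, smul_eq_mul])

/-- Nonnegativity, and below it definiteness, are inherited from `a` through `0 ≤ a ≤ (n + 1) a^D`.
-/
theorem aD_self_nonneg (r : M.W) : 0 ≤ aD P R r r :=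
  nonneg_of_mul_nonneg_right ((a_self_nonneg P R r).trans (a_self_le P R r)) (by positivity)

theorem eq_zero_of_aD_self_eq_zero {r : M.W} (h : aD P R r r = 0) : r = 0 :=
  eq_zero_of_a_self_eq_zero P R <|
    le_antisymm ((a_self_le P R r).trans (by rw [h, mul_zero])) (a_self_nonneg P R r)

/-! ### The form `b` -/

theorem jump_add {d : ℕ} (m m' : M.Ld d) (i : G.I d) (x : Space n) :
    jump (m + m') i x = jump m i x + jump m' i x := by
  simp only [jump, Pi.add_apply, Triangulation.toFun_add, Finset.sum_add_distrib]
  ring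

theorem jump_smul {d : ℕ} (c : ℝ) (m : M.Ld d) (i : G.I d) (x : Space n) :
    jump (c • m) i x = c * jump m i x := by
  simp only [jump, Pi.smul_apply, Triangulation.toFun_smul, Finset.mul_sum, mul_neg]

/-- Needed for additivity of `b` in each argument. Both factors are bounded, and the subdomain has
finite measure because finitely many simplices cover it. -/
theorem integrable_toFun_mul_jump {d : ℕ} (i : G.I d) (q : (M.sub d i).ι → ℝ) (m : M.Ld d) :
    IntegrableOn (fun x => (M.sub d i).toFun q x * jump m i x) (G.dom d i) μHE[d] := by
  have := (M.sub d i).isFiniteMeasure_restrict_dom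
  have hj : Integrable (jump m i) ((μHE[d] : Measure (Space n)).restrict (G.dom d i)) :=
    (integrable_finsetSum _ fun j _ => Triangulation.integrable_toFun _ _ _).neg
  exact hj.bdd_mul ((M.sub d i).measurable_toFun q).aestronglyMeasurable
    (.of_forall ((M.sub d i).norm_toFun_le q))

theorem b_add_left (r r' : M.W) (q : M.Q) : b R (r + r') q = b R r q + b R r' q := by
  have h (d : Fin n) (i : G.I d) := integral_add
    (integrable_toFun_mul_jump i (q ⟨d, by omega⟩ i) (r.2 d))
    (integrable_toFun_mul_jump i (q ⟨d, by omega⟩ i) (r'.2 d))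
  beta_reduce at h
  simp only [b, Prod.snd_add, Pi.add_apply, jump_add, h, total_add, RT.div, Prod.snd_add,
    integral_const, smul_eq_mul, mul_add, Finset.sum_add_distrib]
  ring

theorem b_smul_left (c : ℝ) (r : M.W) (q : M.Q) : b R (c • r) q = c * b R r q := by
  simp only [b, Prod.smul_snd, Pi.smul_apply, jump_smul, total_smul, RT.div, smul_eq_mul,
    mul_left_comm _ c, integral_const_mul, ← Finset.mul_sum, ← mul_add, mul_neg]

theorem b_add_right (r : M.W) (q q' : M.Q) : b R r (q + q') = b R r q + b R r q' := by
  have h (d : Fin n) (i : G.I d) := integral_add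
    (integrable_toFun_mul_jump i (q ⟨d, by omega⟩ i) (r.2 d))
    (integrable_toFun_mul_jump i (q' ⟨d, by omega⟩ i) (r.2 d))
  beta_reduce at h
  simp only [b, Pi.add_apply, Triangulation.toFun_add, h, integral_const, smul_eq_mul, add_mul,
    mul_add, Finset.sum_add_distrib]
  ring

theorem b_smul_right (c : ℝ) (r : M.W) (q : M.Q) : b R r (c • q) = c * b R r q := by
  simp only [b, Pi.smul_apply, Triangulation.toFun_smul, smul_eq_mul, mul_assoc c,
    integral_const_mul, ← Finset.mul_sum, ← mul_add, mul_neg]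

/-- `b` as a bilinear form, in the order `(q, r)`. -/
def bMap : M.Q →ₗ[ℝ] M.W →ₗ[ℝ] ℝ :=
  LinearMap.mk₂ ℝ (fun q r => b R r q) (fun q q' r => b_add_right R r q q')
    (fun c q r => b_smul_right R c r q) (fun q r r' => b_add_left R r r' q)
    (fun c q r => b_smul_left R c r q)

/-! ### The discrete gradient and the inf-sup condition -/

theorem existsUnique_isDiscreteGradient :
    ∃! D : M.Q →ₗ[ℝ] M.W, IsDiscreteGradient P R D :=
  existsUnique_linearMap_of_definite (aDMap P R) (fun _ h => eq_zero_of_aD_self_eq_zero P R h)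
    (bMap R)

/-- The constant is `2 = √4`, since a simplex in dimension at most three has at most four facets. -/
theorem normA_le (hn : n ≤ 3) (r : M.W) : normA P R r ≤ 2 * normAD P R r := by
  have h0 := aD_self_nonneg P R r
  have h4 : ((n + 1 : ℕ) : ℝ) ≤ 2 ^ 2 := by
    norm_num
    exact_mod_cast (by omega : n + 1 ≤ 4)
  rw [normA, normAD, ← Real.sqrt_sq (zero_le_two : (0 : ℝ) ≤ 2), ← Real.sqrt_mul (by positivity)]
  exact Real.sqrt_le_sqrt ((a_self_le P R r).trans (mul_le_mul_of_nonneg_right h4 h0))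

theorem normA_pos {r : M.W} (hr : r ≠ 0) : 0 < normA P R r :=
  Real.sqrt_pos.2 ((a_self_nonneg P R r).lt_of_ne fun h =>
    hr (eq_zero_of_a_self_eq_zero P R h.symm))

theorem normAD_pos {r : M.W} (hr : r ≠ 0) : 0 < normAD P R r :=
  Real.sqrt_pos.2 ((aD_self_nonneg P R r).lt_of_ne fun h =>
    hr (eq_zero_of_aD_self_eq_zero P R h.symm))

/-- With `r` in both slots the quotient reduces to `‖r‖_{a^D} / ‖r‖_a`. -/
theorem inv_le_aD_self_div {c : ℝ} (hc : 0 < c) {r : M.W} (hr : r ≠ 0)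
    (h : normA P R r ≤ c * normAD P R r) :
    c⁻¹ ≤ aD P R r r / (normA P R r * normAD P R r) := by
  have h1 := normA_pos P R hr
  have h2 := normAD_pos P R hr
  have h3 : aD P R r r = normAD P R r * normAD P R r :=
    (Real.mul_self_sqrt (aD_self_nonneg P R r)).symm
  rw [h3, mul_div_mul_right _ _ h2.ne', le_div_iff₀ h1, inv_mul_le_iff₀ hc]
  exact h

end Mesh

end MixedDim

end

theorem mainTheorem3 (σ : ℝ) :
    ∃ c₂ : ℝ, 0 < c₂ ∧
      ∀ (n : ℕ), n = 2 ∨ n = 3 →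
      ∀ (G : MixedDim.Geometry n) (M : MixedDim.Mesh G) (P : MixedDim.Params G),
        M.ShapeRegular σ →
        (∃ R : ∀ d : Fin n, M.Ld d →ₗ[ℝ] M.Vd d, ∀ d : Fin n, M.IsExtension d (R d)) ∧
        ∀ R : ∀ d : Fin n, M.Ld d →ₗ[ℝ] M.Vd d, (∀ d : Fin n, M.IsExtension d (R d)) →
          (∀ r : M.W, MixedDim.Mesh.normA P R r ≤ c₂ * MixedDim.Mesh.normAD P R r) ∧
          (∃! D : M.Q →ₗ[ℝ] M.W, MixedDim.Mesh.IsDiscreteGradient P R D) ∧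
          ∀ D : M.Q →ₗ[ℝ] M.W, MixedDim.Mesh.IsDiscreteGradient P R D →
            ((c₂⁻¹ : ℝ) : EReal) ≤
              ⨅ q : {q : M.Q // D q ≠ 0}, ⨆ r : {r : M.W // r ≠ 0},
                ((MixedDim.Mesh.aD P R (D q) r /
                  (MixedDim.Mesh.normA P R r * MixedDim.Mesh.normAD P R (D q)) : ℝ) : EReal) := by
  refine ⟨2, two_pos, fun n hn G M P _ => ?_⟩
  refine ⟨⟨fun d => MixedDim.Mesh.extension d, fun d => MixedDim.Mesh.isExtension_extension d⟩,
    fun R _ => ?_⟩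
  have hle := MixedDim.Mesh.normA_le P R (by omega)
  refine ⟨hle, MixedDim.Mesh.existsUnique_isDiscreteGradient P R, fun D _ => ?_⟩
  -- The test function is `D q`. In `EReal` the supremum needs no boundedness, and the infimum is
  -- `⊤` if no `q` has `D q ≠ 0`.
  refine le_iInf fun q => le_iSup_of_le ⟨D q, q.2⟩ ?_
  exact EReal.coe_le_coe_iff.2 (MixedDim.Mesh.inv_le_aD_self_div P R two_pos q.2 (hle _))
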